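/- **Setting.** An instance $(G,M,\rho)$ consists of a finite DAG $G$ whose vertices are jobs $v$ of sizes $p_v>0$, machines $1,\dots,m$ of speeds $0<s_1\le\dots\le s_m$ (job $v$ takes time $p_v/s_i$ on machine $i$), and a communication delay $\rho>0$. Write $u\prec v$ if $G$ has a directed path of nonzero length from $u$ to $v$. A schedule assigns to each pair $(v,i)$ a start time in $[0,\infty)\cup\{\infty\}$ ($\infty$ means that $v$ is not processed on $i$), such that every job is processed on at least one machine (copies on several machines are allowed), no two jobs overlap on a machine, and, whenever $u\prec v$ and $v$ starts on $i$ at time $t$, some copy of $u$ completes on $i$ by time $t$ or on a different machine by time $t-\rho$. Its makespan is the largest completion time of a copy of a job; $\mathrm{OPT}$ is the least makespan of a schedule. The linear program LP minimizes $C$ over $C,S_v,x_{v,i},z_{u,v,i}$ subject to $$C\ge S_v+p_v\sum_i x_{v,i}/s_i\ (\forall v),\qquad S_v\ge S_u+p_u\sum_i x_{u,i}/s_i\ (\forall u\prec v),$$ $$S_v\ge S_u+\rho\Big(\sum_{j\le i}x_{v,j}-z_{u,v,i}\Big)\ (\forall u\prec v,\ i),\qquad \sum_{j\le i}x_{v,j}\ge\sum_{u\prec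 v}\frac{p_uz_{u,v,i}}{\rho s_i}\ (\forall v,i),$$ $$Cs_i\ge\sum_v p_vx_{v,i}\ (\forall i),\qquad \sum_i x_{v,i}=1,\ S_v\ge0,\qquad x_{v,i},\,z_{u,v,i}\in[0,1].$$ Its integrality gap on an instance is $\mathrm{OPT}/\mathrm{LP}$, where $\mathrm{LP}$ is the optimal value of the program. A phase is a time interval of length $\rho$. For $d,L,n,m\in\mathbb N$ and $\rho>0$, a *layered instance* has $m$ machines of speed $1$, delay $\rho$ and unit jobs in layers $V_1,\dots,V_L$ of $n$ jobs each; every job in $V_i$, $i<L$, has exactly $d$ immediate predecessors, all in $V_{i+1}$, and there are no other edges. It is *random* if each of these sets of $d$ immediate predecessors is drawn uniformly and independently. **Theorem 2 (Integrality gap).** (1) There is an integer $K\ge1$ such that the random layered instances with $L=1,2,\dots$ layers and parameters $d=2^{KL}$, $m=\rho=d^L$, $n=\lfloor m\rho/L\rfloor$ have the following properties. There are constants $\varepsilon_1,\varepsilon_2>0$ with $L=(1+o(1))\,\varepsilon_1\sqrt{\log_2 n}$ and $d=2^{(1+o(1))\varepsilon_2\sqrt{\log_2 n}}$. For every outcome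 of the random choices LP has a feasible solution of value $\rho$. There is a constant $c>0$ such that, with probability $1-o(1)$ as $L\to\infty$, every schedule has makespan at least $cL\rho$, i.e. needs at least $cL$ phases, and the integrality gap of LP is at least $c\sqrt{\log\rho}$. (2) Consequently LP has integrality gap $\Omega(\sqrt{\log\rho})$ for all sufficiently large $\rho$: there are constants $c,a_1,a_2,b_1,b_2>0$ and $\rho_0$ such that for every real $\rho\ge\rho_0$ there is a layered instance with delay $\rho$ and with $d,L\ge2$, $m=d^L\le\rho<2d^L$, $n=\lfloor m\rho/L\rfloor$, $a_1\sqrt{\log\rho}\le L\le a_2\sqrt{\log\rho}$ and $2^{b_1\sqrt{\log\rho}}\le d\le2^{b_2\sqrt{\log\rho}}$, for which LP has a feasible solution of value $\rho$ (so $0<\mathrm{LP}\le\rho$), schedules exist, every schedule has makespan at least $cL\rho$, and $\mathrm{OPT}/\mathrm{LP}\ge c\sqrt{\log\rho}$. -/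

import Mathlib

open Filter Topology

noncomputable section

/-- An instance `(G, M, ρ)` of precedence-constrained scheduling of jobs with sizes on
uniformly related machines (indexed by increasing speed) with a fixed communication delay. -/
structure SchedInstance where
  Job : Type
  [fintypeJob : Fintype Job]
  /-- `edge u v`: there is a directed edge from `u` to `v` in the precedence graph. -/
  edge : Job → Job → Prop
  acyclic : ∀ v, ¬ Relation.TransGen edge v v
  size : Job → ℝ
  size_pos : ∀ v, 0 < size v
  /-- the number of machines -/
  m : ℕ
  speed : Fin m → ℝ
  speed_pos : ∀ i, 0 < speed i
  speed_mono : Monotone speed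
  /-- the communication delay `ρ` -/
  delay : ℝ
  delay_pos : 0 < delay

attribute [instance] SchedInstance.fintypeJob

namespace SchedInstance

/-- `u ≺ v`: there is a directed path of nonzero length from `u` to `v`. -/
def Pred (I : SchedInstance) (u v : I.Job) : Prop := Relation.TransGen I.edge u v

/-- The time needed to process job `v` on machine `i`. -/
def procTime (I : SchedInstance) (v : I.Job) (i : Fin I.m) : ℝ := I.size v / I.speed i

/-- `σ v i` is the start time of (the copy of) job `v` on machine `i`, and it is `⊤` if `v` is
not scheduled on `i`.  Jobs may be duplicated, i.e. have copies on several machines. -/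
structure IsSchedule (I : SchedInstance) (σ : I.Job → Fin I.m → WithTop ℝ) : Prop where
  nonneg : ∀ v i, 0 ≤ σ v i
  /-- every job is processed on some machine -/
  scheduled : ∀ v, ∃ i, σ v i ≠ ⊤
  /-- no preemption, and at most one job runs on a machine at any time -/
  noOverlap : ∀ i u v, u ≠ v → ∀ s t : ℝ, σ u i = s → σ v i = t →
    s + I.procTime u i ≤ t ∨ t + I.procTime v i ≤ s
  /-- if `u ≺ v` and `v` starts on `i` at time `t`, then a copy of `u` completes on `i` by time
  `t`, or on a different machine by time `t - ρ` -/
  precedence : ∀ u v, I.Pred u v → ∀ i (t : ℝ), σ v i = t →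
    ∃ j, ∃ s : ℝ, σ u j = s ∧
      ((j = i ∧ s + I.procTime u j ≤ t) ∨ (j ≠ i ∧ s + I.procTime u j ≤ t - I.delay))

/-- The makespan: the maximum finite completion time of any copy of any job. -/
def makespan (I : SchedInstance) (σ : I.Job → Fin I.m → WithTop ℝ) : ℝ :=
  sSup {c : ℝ | ∃ v i, ∃ t : ℝ, σ v i = t ∧ c = t + I.procTime v i}

/-- The optimal makespan over all (integral) schedules. -/
def opt (I : SchedInstance) : ℝ := sInf {c : ℝ | ∃ σ, I.IsSchedule σ ∧ c = I.makespan σ}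

open Classical in
/-- `(C, S, x, z)` satisfies all the constraints of the linear program. -/
structure LPConstraints (I : SchedInstance) (C : ℝ) (S : I.Job → ℝ)
    (x : I.Job → Fin I.m → ℝ) (z : I.Job → I.Job → Fin I.m → ℝ) : Prop where
  completion : ∀ v, S v + I.size v * ∑ i, x v i / I.speed i ≤ C
  execution : ∀ u v, I.Pred u v → S u + I.size u * ∑ i, x u i / I.speed i ≤ S v
  delayConstr : ∀ u v i, I.Pred u v →
    S u + I.delay * ((∑ j ∈ Finset.univ.filter (fun j => j ≤ i), x v j) - z u v i) ≤ S v
  phaseConstr : ∀ v i,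
    ∑ u ∈ Finset.univ.filter (fun u => I.Pred u v), I.size u * z u v i / (I.delay * I.speed i)
      ≤ ∑ j ∈ Finset.univ.filter (fun j => j ≤ i), x v j
  load : ∀ i, ∑ v, I.size v * x v i ≤ C * I.speed i
  finish : ∀ v, ∑ i, x v i = 1
  start_nonneg : ∀ v, 0 ≤ S v
  x_mem : ∀ v i, x v i ∈ Set.Icc (0 : ℝ) 1
  z_mem : ∀ u v i, I.Pred u v → z u v i ∈ Set.Icc (0 : ℝ) 1

/-- The linear program has a feasible solution with objective value `C`. -/
def LPFeasible (I : SchedInstance) (C : ℝ) : Prop := ∃ S x z, I.LPConstraints C S x z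

/-- The optimal value of the linear program, which minimizes `C`. -/
def lpValue (I : SchedInstance) : ℝ := sInf {C : ℝ | I.LPFeasible C}

/-- The ratio between the integral optimum and the value of the linear program. -/
def gap (I : SchedInstance) : ℝ := I.opt / I.lpValue

end SchedInstance

/-- The choices that determine a layered graph with `L` layers of `n` vertices each: every vertex
of each layer but the last one chooses `d` distinct vertices of the next layer (listed in some
order, which does not matter for the graph). -/
abbrev LayeredChoice (d L n : ℕ) : Type := Fin (L - 1) → Fin n → (Fin d ↪ Fin n)

/-- `u → v` is an edge iff `u` lies in the layer after the one of `v` and is chosen by `v`.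
The layers `V₁, …, V_L` have the indices `0, …, L - 1`. -/
def layeredEdge {d L n : ℕ} (g : LayeredChoice d L n) (u v : Fin L × Fin n) : Prop :=
  ∃ h : (v.1 : ℕ) < L - 1, (u.1 : ℕ) = v.1 + 1 ∧ ∃ k, g ⟨v.1, h⟩ v.2 k = u.2

theorem layeredEdge_transGen_lt {d L n : ℕ} (g : LayeredChoice d L n) {u v : Fin L × Fin n}
    (h : Relation.TransGen (layeredEdge g) u v) : v.1 < u.1 := by
  induction h with
  | single h => obtain ⟨_, h, _⟩ := h; exact Fin.lt_def.2 (by omega)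
  | tail _ h ih => obtain ⟨_, h, _⟩ := h; exact lt_trans (Fin.lt_def.2 (by omega)) ih

/-- The layered instance: unit jobs `Fin L × Fin n`, `m` machines of unit speed, delay `ρ`. -/
def layeredInstance (d L n m : ℕ) (ρ : ℝ) (hρ : 0 < ρ) (g : LayeredChoice d L n) :
    SchedInstance where
  Job := Fin L × Fin n
  edge := layeredEdge g
  acyclic _ h := lt_irrefl _ (layeredEdge_transGen_lt g h)
  size _ := 1
  size_pos _ := one_pos
  m := m
  speed _ := 1
  speed_pos _ := one_pos
  speed_mono := monotone_const
  delay := ρ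
  delay_pos := hρ

/-- The degree `d` of the random family with `L` layers. -/
def famDegree (K L : ℕ) : ℕ := 2 ^ (K * L)

/-- The delay `ρ = d ^ L` of the random family, which is also its number `m` of machines. -/
def famDelay (K L : ℕ) : ℕ := famDegree K L ^ L

/-- The number `n = ⌊m ρ / L⌋` of jobs per layer, where `m = ρ`. -/
def famWidth (K L : ℕ) : ℕ := famDelay K L * famDelay K L / L

theorem famDelay_pos (K L : ℕ) : (0 : ℝ) < (famDelay K L : ℝ) := by
  unfold famDelay famDegree; positivity

/-- The instances of the random family; the random choices `g` are drawn uniformly. -/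
def famInstance (K L : ℕ) (g : LayeredChoice (famDegree K L) L (famWidth K L)) : SchedInstance :=
  layeredInstance (famDegree K L) L (famWidth K L) (famDelay K L) (famDelay K L)
    (famDelay_pos K L) g

/-- The probability of the event `E` under the uniform distribution on the finite set `Ω`. -/
def uniformProb {Ω : Type} (E : Ω → Prop) : ℝ := (Nat.card {ω // E ω} : ℝ) / Nat.card Ω

end

/-! The gap comes from what the LP cannot see. Fractionally, every job is spread evenly over all
machines and `z` cancels the communication delay completely. The phase constraint then only asks
that a job have at most `ρ` predecessors, which holds because there are at most `d ^ L ≤ ρ` of them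
(`layeredInstance_lpFeasible`). The value is therefore `ρ`, a single phase.

An actual schedule advances about one layer per phase. Within a phase a machine receives nothing
from the other machines that starts in that phase, and it starts at most `⌈ρ⌉` jobs of a layer
itself. A job started by the end of the phase thus has at least half of its `d` immediate
predecessors either among those started earlier or among these `⌈ρ⌉` jobs of its own machine. In an
expanding graph (`IsExpanding`) few jobs are of either kind, so after `p` phases at most a sixteenth
of the `p + 1`-st layer from the bottom has started (`card_started_le`), and the makespan is at
least `(L - 1) ρ`.

Random layers are expanding with probability at least `1 - 2 / n`, by a union bound over the sets
and over the vertices that would violate expansion (`LayerParams.uniformProb_not_isExpanding_le`).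
With `log d` of order `L`, `log ρ` is of order `L ^ 2`, so a gap of order `L` is of order `√(log
ρ)`. -/

/-! ### Uniform probability on finite sets: union bounds and independence. -/

section UniformProb

variable {Ω : Type}

theorem uniformProb_eq_card_filter [Fintype Ω] (E : Ω → Prop) [DecidablePred E] :
    uniformProb E = ((Finset.univ.filter E).card : ℝ) / Fintype.card Ω := by
  rw [uniformProb, Nat.card_eq_fintype_card, Nat.card_eq_fintype_card, Fintype.card_subtype]

theorem uniformProb_nonneg (E : Ω → Prop) : 0 ≤ uniformProb E := by
  unfold uniformProb; positivity

theorem uniformProb_mono [Finite Ω] {E F : Ω → Prop} (h : ∀ ω, E ω → F ω) :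
    uniformProb E ≤ uniformProb F := by
  classical
  have := Fintype.ofFinite Ω
  rw [uniformProb_eq_card_filter, uniformProb_eq_card_filter]
  gcongr with ω
  exact h ω

theorem uniformProb_le_one [Finite Ω] (E : Ω → Prop) : uniformProb E ≤ 1 := by
  classical
  have := Fintype.ofFinite Ω
  rw [uniformProb_eq_card_filter]
  exact div_le_one_of_le₀ (by exact_mod_cast Finset.card_le_univ _) (by positivity)

theorem uniformProb_exists_le [Finite Ω] {ι : Type*} (s : Finset ι) (E : ι → Ω → Prop) :
    uniformProb (fun ω => ∃ i ∈ s, E i ω) ≤ ∑ i ∈ s, uniformProb (E i) := by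
  classical
  have := Fintype.ofFinite Ω
  simp only [uniformProb_eq_card_filter]
  rw [← Finset.sum_div]
  gcongr
  have : Finset.univ.filter (fun ω => ∃ i ∈ s, E i ω)
      = s.biUnion fun i => Finset.univ.filter (E i) := by ext; simp
  rw [this]
  exact_mod_cast Finset.card_biUnion_le

theorem uniformProb_exists_le_card_mul [Finite Ω] {ι : Type*} (s : Finset ι) (E : ι → Ω → Prop)
    {p : ℝ} (h : ∀ i ∈ s, uniformProb (E i) ≤ p) :
    uniformProb (fun ω => ∃ i ∈ s, E i ω) ≤ s.card * p :=
  (uniformProb_exists_le s E).trans <| by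
    simpa using Finset.sum_le_sum h

theorem uniformProb_or_le [Finite Ω] (E F : Ω → Prop) :
    uniformProb (fun ω => E ω ∨ F ω) ≤ uniformProb E + uniformProb F := by
  have := uniformProb_exists_le (Finset.univ : Finset Bool) (fun b ω => if b then E ω else F ω)
  simpa [add_comm, or_comm] using this

theorem one_le_uniformProb_add_not [Finite Ω] [Nonempty Ω] (E : Ω → Prop) :
    1 ≤ uniformProb E + uniformProb (fun ω => ¬ E ω) := by
  have h := uniformProb_or_le E (fun ω => ¬ E ω)
  have h1 : uniformProb (fun ω => E ω ∨ ¬ E ω) = 1 := by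
    classical
    have := Fintype.ofFinite Ω
    rw [uniformProb_eq_card_filter]
    simp [Classical.em]
  linarith

theorem exists_of_uniformProb_pos {E : Ω → Prop} (h : 0 < uniformProb E) : ∃ ω, E ω := by
  by_contra! hE
  have : IsEmpty {ω // E ω} := ⟨fun ω => hE _ ω.2⟩
  simp [uniformProb] at h

theorem uniformProb_pi {ι : Type} [Fintype ι] {α : Type} [Finite α] [Nonempty α]
    (S : Finset ι) (B : α → Prop) :
    uniformProb (fun g : ι → α => ∀ i ∈ S, B (g i)) = uniformProb B ^ S.card := by
  classical
  have h : Nat.card {g : ι → α // ∀ i, i ∈ S → B (g i)}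
      = ∏ i, Nat.card {a : α // i ∈ S → B a} := by
    rw [← Nat.card_pi]
    exact Nat.card_congr (Equiv.subtypePiEquivPi (p := fun i (a : α) => i ∈ S → B a))
  have hα : (Nat.card α : ℝ) ≠ 0 := by exact_mod_cast Nat.card_pos.ne'
  have h2 : ∀ i, (Nat.card {a : α // i ∈ S → B a} : ℝ) / Nat.card α
      = if i ∈ S then uniformProb B else 1 := by
    intro i
    by_cases hi : i ∈ S
    · simp [hi, uniformProb]
    · simp only [hi, false_imp_iff, if_false]
      rw [Nat.card_congr (Equiv.subtypeUnivEquiv fun _ => trivial), div_self hα]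
  rw [uniformProb, h, Nat.card_pi]
  push_cast
  rw [← Finset.prod_div_distrib, Finset.prod_congr rfl fun i _ => h2 i]
  simp

/-- A whole layer is a single coordinate of `g`, so the product formula is applied twice. -/
theorem uniformProb_layer {κ ι : Type} [Fintype κ] [Fintype ι] {α : Type} [Finite α] [Nonempty α]
    (k : κ) (S : Finset ι) (B : α → Prop) :
    uniformProb (fun g : κ → ι → α => ∀ i ∈ S, B (g k i)) = uniformProb B ^ S.card := by
  rw [← uniformProb_pi S B]
  simpa using uniformProb_pi {k} (fun F : ι → α => ∀ i ∈ S, B (F i))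

end UniformProb

/-! ### Random embeddings that hit a given set often. -/

section EmbeddingCount

/-- Factor by factor this is `(t - k) / (n - k) ≤ t / n`. -/
theorem Nat.descFactorial_mul_pow_le {t n : ℕ} (h : t ≤ n) (r : ℕ) :
    t.descFactorial r * n ^ r ≤ n.descFactorial r * t ^ r := by
  induction r with
  | zero => simp
  | succ k ih =>
    have hk : (t - k) * n ≤ (n - k) * t := by
      rw [Nat.sub_mul, Nat.sub_mul, mul_comm n t]
      exact Nat.sub_le_sub_left (Nat.mul_le_mul_left _ h) _
    calc t.descFactorial (k + 1) * n ^ (k + 1)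
        = ((t - k) * n) * (t.descFactorial k * n ^ k) := by rw [Nat.descFactorial_succ]; ring
      _ ≤ ((n - k) * t) * (n.descFactorial k * t ^ k) := Nat.mul_le_mul hk ih
      _ = _ := by rw [Nat.descFactorial_succ]; ring

/-- The left part is embedded into `T` first; the right part then goes anywhere outside its range.
-/
theorem card_sum_embedding_left_mem {α β γ : Type} [Fintype α] [Fintype β] [Fintype γ]
    (T : Finset γ) :
    Nat.card {f : (α ⊕ β) ↪ γ // ∀ a, f (Sum.inl a) ∈ T}
      = T.card.descFactorial (Fintype.card α)
        * (Fintype.card γ - Fintype.card α).descFactorial (Fintype.card β) := by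
  classical
  let e1 : {f : (α ⊕ β) ↪ γ // ∀ a, f (Sum.inl a) ∈ T}
      ≃ {y : Σ f : α ↪ γ, β ↪ ↥(Set.range f)ᶜ // ∀ a, y.1 a ∈ T} :=
    Equiv.subtypeEquiv Equiv.sumEmbeddingEquivSigmaEmbeddingRestricted fun f => Iff.rfl
  let e2 : {y : Σ f : α ↪ γ, β ↪ ↥(Set.range f)ᶜ // ∀ a, y.1 a ∈ T}
      ≃ Σ f : {f : α ↪ γ // ∀ a, f a ∈ T}, β ↪ ↥(Set.range f.1)ᶜ :=
    Equiv.subtypeSigmaEquiv _ (fun f : α ↪ γ => ∀ a, f a ∈ T)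
  let e3 : {f : α ↪ γ // ∀ a, f a ∈ T} ≃ (α ↪ T) :=
    { toFun := fun f => ⟨fun a => ⟨f.1 a, f.2 a⟩, fun a b h => f.1.injective (by simpa using h)⟩
      invFun := fun f => ⟨f.trans (Function.Embedding.subtype _), fun a => (f a).2⟩
      left_inv := fun f => rfl
      right_inv := fun f => rfl }
  have hfib : ∀ f : {f : α ↪ γ // ∀ a, f a ∈ T}, Fintype.card (β ↪ ↥(Set.range f.1)ᶜ)
      = (Fintype.card γ - Fintype.card α).descFactorial (Fintype.card β) := by
    intro f
    rw [Fintype.card_embedding_eq, Fintype.card_compl_set, Set.card_range_of_injective f.1.injective]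
  rw [Nat.card_congr (e1.trans e2), Nat.card_eq_fintype_card, Fintype.card_sigma,
    Finset.sum_congr rfl fun f _ => hfib f, Finset.sum_const, Finset.card_univ,
    Fintype.card_congr e3, Fintype.card_embedding_eq, Fintype.card_coe, smul_eq_mul]

/-- Sampling without replacement hits `T` no more often than sampling with replacement: the
probability is a ratio of falling factorials. -/
theorem uniformProb_embedding_le {δ γ : Type} [Fintype δ] [Fintype γ] [Nonempty (δ ↪ γ)]
    (R : Finset δ) (T : Finset γ) :
    uniformProb (fun f : δ ↪ γ => ∀ k ∈ R, f k ∈ T)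
      ≤ ((T.card : ℝ) / Fintype.card γ) ^ R.card := by
  classical
  let e := Equiv.sumCompl (fun k => k ∈ R)
  have key : ∀ T : Finset γ, Nat.card {f : δ ↪ γ // ∀ k ∈ R, f k ∈ T}
      = T.card.descFactorial R.card
        * (Fintype.card γ - R.card).descFactorial (Fintype.card {k // k ∉ R}) := by
    intro T
    have := card_sum_embedding_left_mem (α := {k // k ∈ R}) (β := {k // k ∉ R}) T
    rw [Fintype.card_coe] at this
    rw [← this]
    refine Nat.card_congr (Equiv.subtypeEquiv (Equiv.embeddingCongr e.symm (Equiv.refl γ)) ?_)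
    intro f
    simp [e, Equiv.embeddingCongr]
  have huniv : Nat.card (δ ↪ γ) = (Fintype.card γ).descFactorial R.card
      * (Fintype.card γ - R.card).descFactorial (Fintype.card {k // k ∉ R}) := by
    have := key Finset.univ
    rw [Finset.card_univ] at this
    rw [← this]
    exact (Nat.card_congr (Equiv.subtypeUnivEquiv fun _ => by simp)).symm
  have hpos : 0 < Nat.card (δ ↪ γ) := Nat.card_pos
  rw [uniformProb, key T]
  rw [huniv] at hpos ⊢
  have h1 := Nat.pos_of_mul_pos_right hpos
  have h2 := Nat.pos_of_mul_pos_left hpos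
  rcases R.eq_empty_or_nonempty with rfl | ⟨a, ha⟩
  · simpa using div_self_le_one _
  have hγ : 0 < Fintype.card γ :=
    Fintype.card_pos_iff.2 ⟨(Classical.arbitrary (δ ↪ γ)) a⟩
  push_cast
  rw [div_pow, div_le_div_iff₀ (by exact_mod_cast hpos) (by positivity)]
  have := Nat.mul_le_mul_right ((Fintype.card γ - R.card).descFactorial
    (Fintype.card {k // k ∉ R})) (Nat.descFactorial_mul_pow_le (Finset.card_le_univ T) R.card)
  have h3 : ((_ : ℕ) : ℝ) ≤ ((_ : ℕ) : ℝ) := Nat.cast_le.2 this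
  push_cast at h3
  nlinarith [h3]

/-- A uniformly random embedding has at least half of its values in `T` with small probability. -/
theorem uniformProb_half_mem_le {d : ℕ} {γ : Type} [Fintype γ] [DecidableEq γ]
    [Nonempty (Fin d ↪ γ)] (T : Finset γ) :
    uniformProb (fun f : Fin d ↪ γ => d ≤ 2 * (Finset.univ.filter fun k => f k ∈ T).card)
      ≤ 2 ^ d * ((T.card : ℝ) / Fintype.card γ) ^ ((d + 1) / 2) := by
  set r := (d + 1) / 2
  -- Union bound over the at most `2 ^ d` sets of `r = ⌈d / 2⌉` positions whose values could all lie
  -- in `T`.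
  let s : Finset (Finset (Fin d)) := Finset.univ.powersetCard r
  have h1 : uniformProb (fun f : Fin d ↪ γ => d ≤ 2 * (Finset.univ.filter fun k => f k ∈ T).card)
      ≤ uniformProb (fun f : Fin d ↪ γ => ∃ R ∈ s, ∀ k ∈ R, f k ∈ T) := by
    refine uniformProb_mono fun f hf => ?_
    obtain ⟨R, hR, hc⟩ := Finset.exists_subset_card_eq
      (show r ≤ (Finset.univ.filter fun k => f k ∈ T).card by omega)
    exact ⟨R, Finset.mem_powersetCard.2 ⟨Finset.subset_univ _, hc⟩,
      fun k hk => (Finset.mem_filter.1 (hR hk)).2⟩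
  refine h1.trans ((uniformProb_exists_le_card_mul s _
    (p := ((T.card : ℝ) / Fintype.card γ) ^ r) fun R hR => ?_).trans ?_)
  · rw [← (Finset.mem_powersetCard.1 hR).2]
    exact uniformProb_embedding_le R T
  · gcongr
    rw [Finset.card_powersetCard, Finset.card_univ, Fintype.card_fin]
    exact_mod_cast Nat.choose_le_two_pow d r

end EmbeddingCount

/-! ### Expansion forces about one phase per layer. -/

section LowerBound

/-- At most `⌈ρ⌉` points with mutual distances at least `1` lie in `[a, a + ρ)`. -/
theorem card_le_ceil_of_separated {α : Type*} (s : Finset α) (τ : α → ℝ) {a ρ : ℝ}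
    (hmem : ∀ x ∈ s, a ≤ τ x ∧ τ x < a + ρ)
    (hsep : ∀ x ∈ s, ∀ y ∈ s, x ≠ y → τ x + 1 ≤ τ y ∨ τ y + 1 ≤ τ x) :
    s.card ≤ ⌈ρ⌉₊ := by
  rw [← Finset.card_range ⌈ρ⌉₊]
  -- Points with the same integer part of `τ x - a` are less than `1` apart, so this map is
  -- injective.
  refine Finset.card_le_card_of_injOn (fun x => ⌊τ x - a⌋₊) ?_ ?_
  · intro x hx
    have h := hmem x hx
    simp only [Finset.coe_range, Set.mem_Iio]
    rw [Nat.floor_lt (by linarith)]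
    linarith [Nat.le_ceil ρ]
  · intro x hx y hy hxy
    by_contra hne
    have hx' := hmem x hx
    have hy' := hmem y hy
    have h1 := Nat.floor_le (show 0 ≤ τ x - a by linarith)
    have h2 := Nat.floor_le (show 0 ≤ τ y - a by linarith)
    have h3 := Nat.lt_floor_add_one (τ x - a)
    have h4 := Nat.lt_floor_add_one (τ y - a)
    simp only at hxy
    rw [hxy] at h1 h3
    rcases hsep x hx y hy hne with h | h <;> linarith

/-- Between consecutive layers, few vertices choose at least half of their predecessors from a
set that contains at most a sixteenth of a layer, or that has at most `t` elements. -/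
def IsExpanding {d L n : ℕ} (m t : ℕ) (g : LayeredChoice d L n) : Prop :=
  ∀ k : Fin (L - 1),
    (∀ D : Finset (Fin n), 16 * D.card ≤ n →
      32 * (Finset.univ.filter fun v =>
        d ≤ 2 * (Finset.univ.filter fun j => g k v j ∈ D).card).card ≤ n) ∧
    (∀ U : Finset (Fin n), U.card ≤ t →
      32 * m * (Finset.univ.filter fun v =>
        d ≤ 2 * (Finset.univ.filter fun j => g k v j ∈ U).card).card ≤ n)

variable {d L n m : ℕ} {ρ : ℝ} {hρ : 0 < ρ} {g : LayeredChoice d L n}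
  {σ : Fin L × Fin n → Fin m → WithTop ℝ}

/-- A job that starts in a phase has each immediate predecessor started before the phase, or on
the same machine in the phase. -/
theorem pred_started (hσ : (layeredInstance d L n m ρ hρ g).IsSchedule σ) {u v : Fin L × Fin n}
    (huv : layeredEdge g u v) {i : Fin m} {t b : ℝ} (ht : σ v i = t) (htb : t < b + ρ) :
    (∃ j, ∃ s : ℝ, σ u j = s ∧ s < b) ∨ ∃ s : ℝ, σ u i = s ∧ b ≤ s ∧ s < b + ρ := by
  obtain ⟨j, s, hs, h⟩ := hσ.precedence u v (Relation.TransGen.single huv) i t ht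
  have hp : (layeredInstance d L n m ρ hρ g).procTime u j = 1 := by
    simp [SchedInstance.procTime, layeredInstance]
  have hd : (layeredInstance d L n m ρ hρ g).delay = ρ := rfl
  rw [hp, hd] at h
  rcases h with ⟨rfl, h⟩ | ⟨-, h⟩
  · rcases lt_or_ge s b with hsb | hsb
    · exact Or.inl ⟨j, s, hs, hsb⟩
    · exact Or.inr ⟨s, hs, hsb, by linarith⟩
  · exact Or.inl ⟨j, s, hs, by linarith⟩

open Classical in
-- Induction on phases, moving up one layer per phase. `D` holds the jobs of the layer below started
-- before the phase, `U i` those started on machine `i` during it. Majority in `D` accounts for `n /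
-- 32` jobs, majority in some `U i` for `m * (n / (32 * m)) ≤ n / 32`; together this restores the
-- bound `n / 16`.
theorem card_started_le (hm : 0 < m) (hg : IsExpanding m ⌈ρ⌉₊ g)
    (hσ : (layeredInstance d L n m ρ hρ g).IsSchedule σ) (p : ℕ) (k : Fin L)
    (hk : (k : ℕ) + p + 1 = L) :
    16 * (Finset.univ.filter fun a : Fin n =>
      ∃ i, ∃ t : ℝ, σ (k, a) i = t ∧ t < p * ρ).card ≤ n := by
  induction p generalizing k with
  | zero =>
    rw [Finset.filter_false_of_mem]
    · simp
    · rintro a - ⟨i, t, ht, h0⟩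
      have := hσ.nonneg (k, a) i
      rw [ht] at this
      have : (0 : ℝ) ≤ t := by exact_mod_cast this
      simp at h0
      linarith
  | succ p ih =>
    have hk1 : (k : ℕ) < L - 1 := by omega
    have hk2 : (k : ℕ) + 1 < L := by omega
    specialize ih ⟨k + 1, hk2⟩ (by simp only; omega)
    set D := Finset.univ.filter fun a : Fin n =>
      ∃ i, ∃ t : ℝ, σ (⟨k + 1, hk2⟩, a) i = t ∧ t < p * ρ with hD
    let U : Fin m → Finset (Fin n) := fun i => Finset.univ.filter fun a =>
      ∃ s : ℝ, σ (⟨k + 1, hk2⟩, a) i = s ∧ p * ρ ≤ s ∧ s < p * ρ + ρ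
    have hU : ∀ i, (U i).card ≤ ⌈ρ⌉₊ := by
      intro i
      -- The default `0` is never used: members of `U i` have finite start times.
      refine card_le_ceil_of_separated (U i) (fun a => (σ (⟨k + 1, hk2⟩, a) i).untopD 0)
        (a := p * ρ) ?_ ?_
      · intro a ha
        obtain ⟨s, hs, h⟩ := (Finset.mem_filter.1 ha).2
        simpa [hs] using h
      · intro a ha b hb hab
        obtain ⟨s, hs, -⟩ := (Finset.mem_filter.1 ha).2
        obtain ⟨t, ht, -⟩ := (Finset.mem_filter.1 hb).2
        have := hσ.noOverlap i (⟨k + 1, hk2⟩, a) (⟨k + 1, hk2⟩, b)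
          (fun h => hab (Prod.ext_iff.1 h).2) s t hs ht
        simpa [hs, ht, SchedInstance.procTime, layeredInstance] using this
    obtain ⟨hgD, hgU⟩ := hg ⟨k, hk1⟩
    let F : Finset (Fin n) → Finset (Fin n) := fun T => Finset.univ.filter fun v =>
        d ≤ 2 * (Finset.univ.filter fun j => g ⟨k, hk1⟩ v j ∈ T).card
    have hsub : (Finset.univ.filter fun a : Fin n =>
        ∃ i, ∃ t : ℝ, σ (k, a) i = t ∧ t < (p + 1 : ℕ) * ρ)
        ⊆ F D ∪ Finset.univ.biUnion fun i => F (U i) := by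
      intro a ha
      obtain ⟨i, t, ht, htp⟩ := (Finset.mem_filter.1 ha).2
      have hcov : (Finset.univ : Finset (Fin d)) ⊆
          (Finset.univ.filter fun j => g ⟨k, hk1⟩ a j ∈ D)
            ∪ (Finset.univ.filter fun j => g ⟨k, hk1⟩ a j ∈ U i) := by
        intro j _
        have hedge : layeredEdge g (⟨k + 1, hk2⟩, g ⟨k, hk1⟩ a j) (k, a) := ⟨hk1, rfl, j, rfl⟩
        have := pred_started hσ hedge ht (b := p * ρ) (by push_cast at htp; linarith)
        simpa [hD, U] using this
      have hc := (Finset.card_le_card hcov).trans (Finset.card_union_le _ _)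
      rw [Finset.card_univ, Fintype.card_fin] at hc
      rw [Finset.mem_union, Finset.mem_biUnion]
      by_cases h : d ≤ 2 * (Finset.univ.filter fun j => g ⟨k, hk1⟩ a j ∈ D).card
      · exact Or.inl (Finset.mem_filter.2 ⟨Finset.mem_univ _, h⟩)
      · exact Or.inr ⟨i, Finset.mem_univ _, Finset.mem_filter.2 ⟨Finset.mem_univ _, by omega⟩⟩
    have h1 : 32 * (F D).card ≤ n := by convert hgD D ih
    have h2 : ∀ i, (F (U i)).card ≤ n / (32 * m) := by
      intro i
      rw [Nat.le_div_iff_mul_le (by omega), mul_comm]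
      convert hgU (U i) (hU i)
    have h3 : (Finset.univ.biUnion fun i => F (U i)).card ≤ m * (n / (32 * m)) := by
      refine Finset.card_biUnion_le.trans ((Finset.sum_le_card_nsmul _ _ _ fun i _ => h2 i).trans ?_)
      simp
    have h4 : 32 * (m * (n / (32 * m))) ≤ n := by
      rw [← mul_assoc]; exact Nat.mul_div_le _ _
    have h5 := (Finset.card_le_card hsub).trans (Finset.card_union_le _ _)
    omega

/-- Without this the `sSup` defining the makespan could be the default value `0`. -/
theorem makespan_bddAbove (I : SchedInstance) (σ : I.Job → Fin I.m → WithTop ℝ) :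
    BddAbove {c : ℝ | ∃ v i, ∃ t : ℝ, σ v i = t ∧ c = t + I.procTime v i} := by
  refine (Set.Finite.subset (Set.finite_range fun q : I.Job × Fin I.m =>
    (σ q.1 q.2).untopD 0 + I.procTime q.1 q.2) ?_).bddAbove
  rintro c ⟨v, i, t, ht, rfl⟩
  exact ⟨(v, i), by simp [ht]⟩

theorem le_makespan {I : SchedInstance} {σ : I.Job → Fin I.m → WithTop ℝ} {v : I.Job}
    {i : Fin I.m} {t : ℝ} (ht : σ v i = t) : t + I.procTime v i ≤ I.makespan σ :=
  le_csSup (makespan_bddAbove I σ) ⟨v, i, t, ht, rfl⟩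

theorem makespan_lower_bound (hm : 0 < m) (hL : 2 ≤ L) (hn : 0 < n) (hg : IsExpanding m ⌈ρ⌉₊ g)
    (hσ : (layeredInstance d L n m ρ hρ g).IsSchedule σ) :
    1 / 2 * L * ρ ≤ (layeredInstance d L n m ρ hρ g).makespan σ := by
  classical
  have h := card_started_le hm hg hσ (L - 1) ⟨0, by omega⟩ (by simp only; omega)
  obtain ⟨a, ha⟩ : ∃ a : Fin n, ¬ ∃ i, ∃ t : ℝ, σ (⟨0, by omega⟩, a) i = t ∧ t < (L - 1 : ℕ) * ρ := by
    by_contra! hall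
    rw [Finset.filter_true_of_mem fun a _ => hall a, Finset.card_univ, Fintype.card_fin] at h
    omega
  obtain ⟨i, hi⟩ := hσ.scheduled (⟨0, by omega⟩, a)
  obtain ⟨t, ht⟩ := WithTop.ne_top_iff_exists.1 hi
  have h1 : ((L - 1 : ℕ) : ℝ) * ρ ≤ t := by
    by_contra! hlt
    exact ha ⟨i, t, ht.symm, hlt⟩
  have h2 := le_makespan (I := layeredInstance d L n m ρ hρ g) ht.symm
  have h3 : (layeredInstance d L n m ρ hρ g).procTime (⟨0, by omega⟩, a) i = 1 := by
    simp [SchedInstance.procTime, layeredInstance]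
  rw [h3] at h2
  have h4 : (1 / 2 * L : ℝ) ≤ ((L - 1 : ℕ) : ℝ) := by
    rw [Nat.cast_sub (by omega)]
    have : (2 : ℝ) ≤ L := by exact_mod_cast hL
    push_cast; linarith
  nlinarith

end LowerBound

/-! ### The fractional solution of value `ρ`, and the passage to the gap. -/

section LinearProgram

variable {d L n m : ℕ} {ρ : ℝ}

theorem layeredEdge_card_le (g : LayeredChoice d L n) [DecidableRel (layeredEdge g)]
    (v : Fin L × Fin n) : (Finset.univ.filter fun u => layeredEdge g u v).card ≤ d := by
  by_cases h : (v.1 : ℕ) < L - 1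
  · have hsub : (Finset.univ.filter fun u => layeredEdge g u v) ⊆
        Finset.univ.image fun k : Fin d =>
          ((⟨v.1 + 1, by omega⟩, g ⟨v.1, h⟩ v.2 k) : Fin L × Fin n) := by
      intro u hu
      obtain ⟨_, h1, k, hk⟩ := (Finset.mem_filter.1 hu).2
      refine Finset.mem_image.2 ⟨k, Finset.mem_univ _, Prod.ext (Fin.ext h1.symm) hk⟩
    exact (Finset.card_le_card hsub).trans (Finset.card_image_le.trans (by simp))
  · rw [Finset.filter_false_of_mem]
    · simp
    · rintro u - ⟨h', -⟩
      exact h h'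

open Classical in
/-- The vertices from which there is a path of length `j` to `v`. -/
noncomputable def ancestorsAt (g : LayeredChoice d L n) (v : Fin L × Fin n) : ℕ → Finset (Fin L × Fin n)
  | 0 => {v}
  | j + 1 => (ancestorsAt g v j).biUnion fun w => Finset.univ.filter fun u => layeredEdge g u w

theorem card_ancestorsAt_le (g : LayeredChoice d L n) (v : Fin L × Fin n) (j : ℕ) :
    (ancestorsAt g v j).card ≤ d ^ j := by
  classical
  induction j with
  | zero => simp [ancestorsAt]
  | succ j ih =>
    rw [pow_succ]
    refine (Finset.card_biUnion_le_card_mul _ _ d fun w _ => ?_).trans (Nat.mul_le_mul_right d ih)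
    convert layeredEdge_card_le g w

theorem layer_of_mem_ancestorsAt (g : LayeredChoice d L n) (v : Fin L × Fin n) (j : ℕ) :
    ∀ u ∈ ancestorsAt g v j, (u.1 : ℕ) = v.1 + j := by
  induction j with
  | zero => intro u hu; simp [ancestorsAt] at hu; simp [hu]
  | succ j ih =>
    intro u hu
    simp only [ancestorsAt, Finset.mem_biUnion, Finset.mem_filter, Finset.mem_univ,
      true_and] at hu
    obtain ⟨w, hw, _, h, _⟩ := hu
    rw [h, ih w hw, add_assoc]

theorem exists_mem_ancestorsAt (g : LayeredChoice d L n) {u v : Fin L × Fin n}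
    (h : Relation.TransGen (layeredEdge g) u v) : ∃ j, u ∈ ancestorsAt g v j := by
  induction h using Relation.TransGen.head_induction_on with
  | single h => exact ⟨1, by simpa [ancestorsAt] using h⟩
  | head h _ ih =>
    obtain ⟨j, hj⟩ := ih
    refine ⟨j + 1, ?_⟩
    simp only [ancestorsAt, Finset.mem_biUnion, Finset.mem_filter, Finset.mem_univ, true_and]
    exact ⟨_, hj, h⟩

open Classical in
-- At most `d ^ j` predecessors have a path of length `j`, and `j < L`; the geometric sum stays
-- below `d ^ L` because `2 ≤ d`.
theorem card_pred_le (hd : 2 ≤ d) (g : LayeredChoice d L n) (v : Fin L × Fin n) :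
    (Finset.univ.filter fun u => Relation.TransGen (layeredEdge g) u v).card ≤ d ^ L := by
  have hsub : (Finset.univ.filter fun u => Relation.TransGen (layeredEdge g) u v) ⊆
      (Finset.range L).biUnion (ancestorsAt g v) := by
    intro u hu
    obtain ⟨j, hj⟩ := exists_mem_ancestorsAt g (Finset.mem_filter.1 hu).2
    refine Finset.mem_biUnion.2 ⟨j, Finset.mem_range.2 ?_, hj⟩
    have := layer_of_mem_ancestorsAt g v j u hj
    omega
  calc _ ≤ _ := Finset.card_le_card hsub
    _ ≤ ∑ j ∈ Finset.range L, (ancestorsAt g v j).card := Finset.card_biUnion_le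
    _ ≤ ∑ j ∈ Finset.range L, d ^ j := Finset.sum_le_sum fun j _ => card_ancestorsAt_le g v j
    _ ≤ d ^ L := (Nat.geomSum_lt hd fun j hj => Finset.mem_range.1 hj).le

/-- Taking `z u v i` equal to the partial sum of `x v` makes the delay constraint void, so start
times need only count layers. The phase constraint becomes the bound `d ^ L ≤ ρ` on predecessors,
and the load is `L * n / m ≤ ρ`. -/
theorem layeredInstance_lpFeasible (hd : 2 ≤ d) (hm : 0 < m) (hρ : 0 < ρ)
    (hdρ : ((d ^ L : ℕ) : ℝ) ≤ ρ) (hn : (L * n : ℝ) ≤ m * ρ) (g : LayeredChoice d L n) :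
    (layeredInstance d L n m ρ hρ g).LPFeasible ρ := by
  classical
  have hm' : (0 : ℝ) < m := by exact_mod_cast hm
  have hLρ : (L : ℝ) ≤ ρ := le_trans (by exact_mod_cast (Nat.lt_pow_self hd).le) hdρ
  have hpart : ∀ i : Fin m, (∑ j ∈ Finset.univ.filter (fun j => j ≤ i), (1 / m : ℝ))
      ∈ Set.Icc (0 : ℝ) 1 := by
    intro i
    refine ⟨Finset.sum_nonneg fun _ _ => by positivity, ?_⟩
    refine (Finset.sum_le_univ_sum_of_nonneg fun _ => by positivity).trans ?_
    simp [hm'.ne']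
  have hfull : ∑ _i : Fin m, (1 / m : ℝ) / 1 = 1 := by simp [hm'.ne']
  refine ⟨fun v => L - 1 - (v.1 : ℕ), fun _ _ => 1 / m,
    fun _ _ i => ∑ j ∈ Finset.univ.filter (fun j => j ≤ i), (1 / m : ℝ), ?_⟩
  refine ⟨?_, ?_, ?_, ?_, ?_, ?_, ?_, ?_, ?_⟩
  · intro v
    change (L : ℝ) - 1 - (v.1 : ℕ) + 1 * ∑ _i : Fin m, (1 / m : ℝ) / 1 ≤ ρ
    rw [hfull]
    have : (0 : ℝ) ≤ (v.1 : ℕ) := by positivity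
    linarith
  · intro u v huv
    change (L : ℝ) - 1 - (u.1 : ℕ) + 1 * ∑ _i : Fin m, (1 / m : ℝ) / 1 ≤ L - 1 - (v.1 : ℕ)
    rw [hfull]
    have h : (v.1 : ℕ) + 1 ≤ u.1 := layeredEdge_transGen_lt g huv
    have : ((v.1 : ℕ) : ℝ) + 1 ≤ (u.1 : ℕ) := by exact_mod_cast h
    linarith
  · intro u v i huv
    have h : (v.1 : ℕ) ≤ u.1 := (layeredEdge_transGen_lt g huv).le
    have : ((v.1 : ℕ) : ℝ) ≤ (u.1 : ℕ) := by exact_mod_cast h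
    rw [sub_self]
    linarith
  · intro v i
    change ∑ u ∈ Finset.univ.filter (fun u => Relation.TransGen (layeredEdge g) u v),
      1 * (∑ j ∈ Finset.univ.filter (fun j => j ≤ i), (1 / m : ℝ)) / (ρ * 1) ≤ _
    rw [Finset.sum_const, nsmul_eq_mul, one_mul, mul_one, mul_div_assoc', div_le_iff₀ hρ, mul_comm]
    refine mul_le_mul_of_nonneg_left ?_ (hpart i).1
    refine le_trans ?_ hdρ
    exact_mod_cast card_pred_le hd g v
  · intro i
    change ∑ _v : Fin L × Fin n, 1 * (1 / m : ℝ) ≤ ρ * 1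
    simp only [Finset.sum_const, Finset.card_univ, Fintype.card_prod, Fintype.card_fin,
      nsmul_eq_mul]
    push_cast
    rw [one_mul, mul_one, mul_one_div, div_le_iff₀ hm']
    linarith
  · intro v
    change ∑ _i : Fin m, (1 / m : ℝ) = 1
    simp [hm'.ne']
  · intro v
    have h : ((v.1 : ℕ) : ℝ) + 1 ≤ L := by exact_mod_cast v.1.2
    linarith
  · intro v i
    refine ⟨by positivity, ?_⟩
    rw [div_le_one hm']
    exact_mod_cast hm
  · intro u v i _
    exact hpart i

/-- A unit job takes time `1` even fractionally. This bounds the LP values below and makes the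
division in `gap` meaningful. -/
theorem one_le_of_lpFeasible {hρ : 0 < ρ} {g : LayeredChoice d L n} (hL : 0 < L) (hn : 0 < n)
    {C : ℝ} (h : (layeredInstance d L n m ρ hρ g).LPFeasible C) : 1 ≤ C := by
  obtain ⟨S, x, z, h⟩ := h
  have h1 := h.completion (⟨0, hL⟩, ⟨0, hn⟩)
  have h2 := h.start_nonneg (⟨0, hL⟩, ⟨0, hn⟩)
  have h3 := h.finish (⟨0, hL⟩, ⟨0, hn⟩)
  have h4 : (layeredInstance d L n m ρ hρ g).size (⟨0, hL⟩, ⟨0, hn⟩)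
      * ∑ i, x (⟨0, hL⟩, ⟨0, hn⟩) i / (layeredInstance d L n m ρ hρ g).speed i = 1 := by
    change 1 * ∑ i, x (⟨0, hL⟩, ⟨0, hn⟩) i / 1 = 1
    simpa using h3
  rw [h4] at h1
  linarith

theorem lpValue_mem_Icc {hρ : 0 < ρ} {g : LayeredChoice d L n} (hL : 0 < L) (hn : 0 < n)
    {C : ℝ} (h : (layeredInstance d L n m ρ hρ g).LPFeasible C) :
    (layeredInstance d L n m ρ hρ g).lpValue ∈ Set.Icc 1 C :=
  ⟨le_csInf ⟨C, h⟩ fun _ h' => one_le_of_lpFeasible hL hn h',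
    csInf_le ⟨1, fun _ h' => one_le_of_lpFeasible hL hn h'⟩ h⟩

/-- All jobs can be scheduled on one machine, layer by layer. -/
theorem exists_isSchedule (hm : 0 < m) (hρ : 0 < ρ) (g : LayeredChoice d L n) :
    ∃ σ, (layeredInstance d L n m ρ hρ g).IsSchedule σ := by
  classical
  -- The position of a job on machine `0`; the layer with index `L - 1`, which has no predecessors,
  -- comes first.
  let f : Fin L × Fin n → ℕ := fun v => (L - 1 - v.1) * n + v.2
  have hproc : ∀ v i, (layeredInstance d L n m ρ hρ g).procTime v i = 1 := by
    simp [SchedInstance.procTime, layeredInstance]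
  have hf : Function.Injective f := by
    intro u v h
    have hu := u.2.2
    have hv := v.2.2
    have hn : 0 < n := by omega
    have h1 : f u / n = L - 1 - u.1 := by
      simp only [f]; rw [mul_comm, Nat.mul_add_div hn, Nat.div_eq_of_lt hu, add_zero]
    have h2 : f v / n = L - 1 - v.1 := by
      simp only [f]; rw [mul_comm, Nat.mul_add_div hn, Nat.div_eq_of_lt hv, add_zero]
    have h3 : f u % n = u.2 := by
      simp only [f]; rw [mul_comm, Nat.mul_add_mod, Nat.mod_eq_of_lt hu]
    have h4 : f v % n = v.2 := by
      simp only [f]; rw [mul_comm, Nat.mul_add_mod, Nat.mod_eq_of_lt hv]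
    have := u.1.2
    have := v.1.2
    rw [h] at h1 h3
    exact Prod.ext (Fin.ext (by omega)) (Fin.ext (by omega))
  let σ : Fin L × Fin n → Fin m → WithTop ℝ := fun v i =>
    if i = ⟨0, hm⟩ then (((f v : ℕ) : ℝ) : WithTop ℝ) else ⊤
  have hσ0 : ∀ v, σ v ⟨0, hm⟩ = (((f v : ℕ) : ℝ) : WithTop ℝ) := fun v => if_pos rfl
  have hσ : ∀ {v i} {t : ℝ}, σ v i = t → i = ⟨0, hm⟩ ∧ t = f v := by
    intro v i t h
    by_cases hi : i = ⟨0, hm⟩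
    · simp only [σ, hi, if_true] at h
      exact ⟨hi, (WithTop.coe_injective h).symm⟩
    · simp [σ, hi] at h
  refine ⟨σ, ?_, ?_, ?_, ?_⟩
  · intro (v : Fin L × Fin n) (i : Fin m)
    by_cases hi : i = ⟨0, hm⟩
    · rw [hi, hσ0]
      exact WithTop.coe_le_coe.2 (Nat.cast_nonneg (f v))
    · simp [σ, hi]
  · intro v
    exact ⟨⟨0, hm⟩, (hσ0 v).trans_ne WithTop.coe_ne_top⟩
  · intro i u v huv s t hs ht
    obtain ⟨-, rfl⟩ := hσ hs
    obtain ⟨-, rfl⟩ := hσ ht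
    rw [hproc, hproc]
    rcases lt_or_gt_of_ne (hf.ne huv) with h | h
    · exact Or.inl (by exact_mod_cast h)
    · exact Or.inr (by exact_mod_cast h)
  · intro u v huv i t ht
    obtain ⟨rfl, rfl⟩ := hσ ht
    refine ⟨⟨0, hm⟩, (f u : ℕ), hσ0 u, Or.inl ⟨rfl, ?_⟩⟩
    rw [hproc]
    have h : (v.1 : ℕ) < u.1 := layeredEdge_transGen_lt g huv
    have hu := u.2.2
    have hlt : f u + 1 ≤ f v := by
      have h1 : L - 1 - (u.1 : ℕ) + 1 ≤ L - 1 - v.1 := by have := u.1.2; omega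
      have h2 := Nat.mul_le_mul_right n h1
      rw [add_mul, one_mul] at h2
      simp only [f]
      omega
    exact_mod_cast hlt

/-- A schedule must exist for the bound on `opt`, since the real infimum of the empty set is `0`. -/
theorem gap_lower_bound {hρ : 0 < ρ} {g : LayeredChoice d L n} (hm : 0 < m) (hL : 0 < L)
    (hn : 0 < n) (hLP : (layeredInstance d L n m ρ hρ g).LPFeasible ρ) {c : ℝ}
    (h : ∀ σ, (layeredInstance d L n m ρ hρ g).IsSchedule σ →
      c * ρ ≤ (layeredInstance d L n m ρ hρ g).makespan σ) (hc : 0 ≤ c) :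
    c ≤ (layeredInstance d L n m ρ hρ g).gap := by
  obtain ⟨h1, h2⟩ := lpValue_mem_Icc hL hn hLP
  obtain ⟨σ, hσ⟩ := exists_isSchedule hm hρ g
  have hopt : c * ρ ≤ (layeredInstance d L n m ρ hρ g).opt := by
    refine le_csInf ⟨_, σ, hσ, rfl⟩ ?_
    rintro _ ⟨τ, hτ, rfl⟩
    exact h τ hτ
  rw [SchedInstance.gap, le_div_iff₀ (by linarith)]
  exact (mul_le_mul_of_nonneg_left h2 hc).trans hopt

end LinearProgram

/-! ### Random layers are expanding with high probability. -/

section RandomLayers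

/-- Union bound over the layer, the set `T` and the `w` vertices that favour `T`; these vertices
choose independently, whence the power `w`. -/
theorem uniformProb_exists_many_le {d L n : ℕ} [Nonempty (Fin d ↪ Fin n)] (hn : 0 < n)
    (𝒯 : Finset (Finset (Fin n))) {q : ℝ} (hq : ∀ T ∈ 𝒯, (T.card : ℝ) ≤ q * n) (w : ℕ) :
    uniformProb (fun g : LayeredChoice d L n => ∃ k, ∃ T ∈ 𝒯,
      w ≤ (Finset.univ.filter fun v =>
        d ≤ 2 * (Finset.univ.filter fun j => g k v j ∈ T).card).card)
      ≤ L * (𝒯.card * (n.choose w * (2 ^ d * q ^ ((d + 1) / 2)) ^ w)) := by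
  classical
  let bad : Finset (Fin n) → (Fin d ↪ Fin n) → Prop := fun T f =>
    d ≤ 2 * (Finset.univ.filter fun j => f j ∈ T).card
  have hn' : (0 : ℝ) < n := by exact_mod_cast hn
  have hbad : ∀ T ∈ 𝒯, uniformProb (bad T) ≤ 2 ^ d * q ^ ((d + 1) / 2) := by
    intro T hT
    refine (uniformProb_half_mem_le T).trans ?_
    rw [Fintype.card_fin]
    gcongr
    rw [div_le_iff₀ hn']
    exact hq T hT
  let s : Finset (Fin (L - 1) × Finset (Fin n) × Finset (Fin n)) :=
    Finset.univ ×ˢ (𝒯 ×ˢ Finset.univ.powersetCard w)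
  have h1 : uniformProb (fun g : LayeredChoice d L n => ∃ k, ∃ T ∈ 𝒯,
      w ≤ (Finset.univ.filter fun v =>
        d ≤ 2 * (Finset.univ.filter fun j => g k v j ∈ T).card).card)
      ≤ uniformProb (fun g : LayeredChoice d L n =>
        ∃ i ∈ s, ∀ v ∈ i.2.2, bad i.2.1 (g i.1 v)) := by
    refine uniformProb_mono fun g ⟨k, T, hT, hw⟩ => ?_
    obtain ⟨W, hW, hc⟩ := Finset.exists_subset_card_eq hw
    refine ⟨(k, T, W), ?_, fun v hv => (Finset.mem_filter.1 (hW hv)).2⟩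
    simp only [s, Finset.mem_product, Finset.mem_univ, true_and, Finset.mem_powersetCard]
    exact ⟨hT, Finset.subset_univ _, hc⟩
  refine h1.trans ((uniformProb_exists_le_card_mul s _
    (p := (2 ^ d * q ^ ((d + 1) / 2)) ^ w) fun i hi => ?_).trans ?_)
  · simp only [s, Finset.mem_product, Finset.mem_univ, true_and, Finset.mem_powersetCard] at hi
    rw [uniformProb_layer, hi.2.2]
    exact pow_le_pow_left₀ (uniformProb_nonneg _) (hbad _ hi.1) _
  -- The sign of `q` is known only through a member of `𝒯`.
  · rcases 𝒯.eq_empty_or_nonempty with h0 | ⟨T, hT⟩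
    · simp [s, h0]
    have hp : 0 ≤ (2 ^ d * q ^ ((d + 1) / 2) : ℝ) :=
      (uniformProb_nonneg _).trans (hbad T hT)
    simp only [s, Finset.card_product, Finset.card_univ, Fintype.card_fin,
      Finset.card_powersetCard]
    push_cast
    rw [mul_assoc, mul_assoc]
    gcongr
    exact Nat.sub_le _ _

/-- A vertex is bad with probability at most `2 ^ (-d)`, and `d * w ≥ 4 * n`. The resulting `2 ^ (-4
n)` pays for four factors of at most `2 ^ n`: sets, vertex sets, `L`, and the `n` of the target. -/
theorem union_bound_small_sets {d L n w : ℕ} (hd : 128 ≤ d) (hLn : L ≤ n) (hn : 0 < n)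
    (hw : n ≤ 32 * w) :
    (L : ℝ) * (2 ^ n * (2 ^ n * (2 ^ d * (1 / 16) ^ ((d + 1) / 2)) ^ w)) ≤ 1 / n := by
  have hn' : (0 : ℝ) < n := by exact_mod_cast hn
  have h1 : (2 ^ d * (1 / 16) ^ ((d + 1) / 2) : ℝ) ≤ (1 / 2) ^ d := by
    have : ((1 / 16 : ℝ)) ^ ((d + 1) / 2) ≤ (1 / 4) ^ d := by
      rw [show (1 / 16 : ℝ) = (1 / 4) ^ 2 by norm_num, ← pow_mul]
      exact pow_le_pow_of_le_one (by norm_num) (by norm_num) (by omega)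
    calc (2 ^ d * (1 / 16) ^ ((d + 1) / 2) : ℝ) ≤ 2 ^ d * (1 / 4) ^ d := by gcongr
      _ = (1 / 2) ^ d := by rw [← mul_pow]; norm_num
  have h2 : ((2 ^ d * (1 / 16) ^ ((d + 1) / 2)) ^ w : ℝ) ≤ (1 / 2) ^ (4 * n) := by
    calc ((2 ^ d * (1 / 16) ^ ((d + 1) / 2)) ^ w : ℝ) ≤ ((1 / 2) ^ d) ^ w := by gcongr
      _ = (1 / 2) ^ (d * w) := (pow_mul _ _ _).symm
      _ ≤ (1 / 2) ^ (4 * n) := pow_le_pow_of_le_one (by norm_num) (by norm_num) (by nlinarith)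
  have h3 : (n : ℝ) ≤ 2 ^ n := by exact_mod_cast Nat.lt_two_pow_self.le
  have h4 : (L : ℝ) ≤ 2 ^ n := le_trans (by exact_mod_cast hLn) h3
  rw [le_div_iff₀ hn']
  calc (L : ℝ) * (2 ^ n * (2 ^ n * (2 ^ d * (1 / 16) ^ ((d + 1) / 2)) ^ w)) * n
      ≤ 2 ^ n * (2 ^ n * (2 ^ n * (1 / 2) ^ (4 * n))) * 2 ^ n := by gcongr
    _ = (2 * (2 * (2 * (1 / 2) ^ 4)) * 2) ^ n := by simp only [mul_pow, pow_mul]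
    _ = 1 := by norm_num

/-- With `(4 t / n) ^ 4 ≤ 1 / n` a vertex is bad with probability at most `n ^ (-e)`. The exponent
`e * w` must cover `t` for the set, `w` for the vertices, and `2` for `L` and the target. -/
theorem union_bound_machine_sets {d L n t w e : ℕ} (he : 8 * e ≤ d) (hLn : L ≤ n) (hn : 0 < n)
    (ht : 256 * t ^ 4 ≤ n ^ 3) (hw : t + w + 2 ≤ e * w) :
    (L : ℝ) * (n ^ t * (n ^ w * (2 ^ d * (t / n : ℝ) ^ ((d + 1) / 2)) ^ w)) ≤ 1 / n := by
  have hn' : (0 : ℝ) < n := by exact_mod_cast hn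
  have hn1 : (1 / n : ℝ) ≤ 1 := by
    rw [div_le_one hn']; exact_mod_cast hn
  set r := (d + 1) / 2
  set q : ℝ := 4 * (t / n) with hq
  have hq0 : 0 ≤ q := by positivity
  have hq4 : q ^ 4 ≤ 1 / n := by
    have : (256 * t ^ 4 : ℝ) ≤ n ^ 3 := by exact_mod_cast ht
    rw [hq, mul_pow, div_pow, mul_div_assoc', div_le_div_iff₀ (by positivity) hn']
    calc (4 : ℝ) ^ 4 * (t : ℝ) ^ 4 * n = (256 * (t : ℝ) ^ 4) * n := by norm_num
      _ ≤ (n : ℝ) ^ 3 * n := by gcongr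
      _ = 1 * (n : ℝ) ^ 4 := by ring
  have hq1 : q ≤ 1 := by
    by_contra! h
    have : 1 < q ^ 4 := one_lt_pow₀ h (by norm_num)
    linarith
  have h1 : (2 ^ d * (t / n : ℝ) ^ r : ℝ) ≤ (1 / n) ^ e := by
    calc (2 ^ d * (t / n : ℝ) ^ r : ℝ) ≤ 2 ^ (2 * r) * (t / n : ℝ) ^ r := by
          gcongr
          · norm_num
          · omega
      _ = q ^ r := by rw [pow_mul, ← mul_pow, hq]; norm_num
      _ ≤ q ^ (4 * e) := pow_le_pow_of_le_one hq0 hq1 (by omega)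
      _ = (q ^ 4) ^ e := pow_mul _ _ _
      _ ≤ (1 / n) ^ e := by gcongr
  have h2 : ((2 ^ d * (t / n : ℝ) ^ r) ^ w : ℝ) ≤ (1 / n) ^ (t + w + 2) := by
    calc ((2 ^ d * (t / n : ℝ) ^ r) ^ w : ℝ) ≤ ((1 / n) ^ e) ^ w := by gcongr
      _ = (1 / n) ^ (e * w) := (pow_mul _ _ _).symm
      _ ≤ _ := pow_le_pow_of_le_one (by positivity) hn1 hw
  have h4 : (L : ℝ) ≤ n := by exact_mod_cast hLn
  calc (L : ℝ) * (n ^ t * (n ^ w * (2 ^ d * (t / n : ℝ) ^ r) ^ w))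
      ≤ n * (n ^ t * (n ^ w * (1 / n) ^ (t + w + 2))) := by gcongr
    _ = 1 / n := by
      rw [one_div, inv_pow, pow_add, pow_add]; field_simp

/-- The conditions on degree, number of layers, number of machines, delay, and layer width under
which random layers are expanding. -/
structure LayerParams (d L m n : ℕ) (ρ : ℝ) : Prop where
  two_le : 2 ≤ L
  degree : 4096 * L ≤ d
  machines : m = d ^ L
  machines_le : (m : ℝ) ≤ ρ
  lt_machines : ρ < 2 * m
  width : n = ⌊m * ρ / L⌋₊

namespace LayerParams

variable {d L m n : ℕ} {ρ : ℝ}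

theorem degree_sq_le (h : LayerParams d L m n ρ) : d ^ 2 ≤ m := by
  rw [h.machines]
  exact Nat.pow_le_pow_right (by have := h.degree; have := h.two_le; omega) h.two_le

theorem two_le_degree (h : LayerParams d L m n ρ) : 2 ≤ d := by
  have := h.degree; have := h.two_le; omega

theorem machines_pos (h : LayerParams d L m n ρ) : 0 < m := by
  have := h.degree_sq_le; have := h.two_le_degree; nlinarith

theorem delay_pos (h : LayerParams d L m n ρ) : 0 < ρ :=
  lt_of_lt_of_le (by exact_mod_cast h.machines_pos) h.machines_le

theorem mul_width_le (h : LayerParams d L m n ρ) : (L * n : ℝ) ≤ m * ρ := by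
  have hL : (0 : ℝ) < L := by have := h.two_le; exact_mod_cast (by omega : 0 < L)
  have := Nat.floor_le (show 0 ≤ m * ρ / L by have := h.delay_pos; positivity)
  rw [← h.width, le_div_iff₀ hL] at this
  linarith

theorem machines_ge (h : LayerParams d L m n ρ) : (4096 * L : ℝ) ^ 2 ≤ m := by
  have h1 : (4096 * L) ^ 2 ≤ m := (Nat.pow_le_pow_left h.degree 2).trans h.degree_sq_le
  exact_mod_cast h1

theorem le_mul_width (h : LayerParams d L m n ρ) : (m * ρ : ℝ) ≤ 2 * L * n := by
  have hL2 : (2 : ℝ) ≤ L := by exact_mod_cast h.two_le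
  have h1 := Nat.lt_floor_add_one (m * ρ / L)
  rw [← h.width, div_lt_iff₀ (by linarith)] at h1
  have h2 := h.machines_ge
  have h3 := h.machines_le
  have h4 : (2 * L : ℝ) ≤ m := by nlinarith
  have h5 : (1 : ℝ) ≤ ρ := by linarith
  nlinarith

/-- The constant is `4096 ^ 2 / 2`: cancel `2 L` in `m (4096 L) ^ 2 ≤ m ρ ≤ 2 L n`. -/
theorem machines_mul_le (h : LayerParams d L m n ρ) : (m * (8388608 * L) : ℝ) ≤ n := by
  have hL2 : (2 : ℝ) ≤ L := by exact_mod_cast h.two_le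
  have h1 := h.le_mul_width
  have h2 := h.machines_ge
  have h3 := h.machines_le
  have hm : (0 : ℝ) < m := by exact_mod_cast h.machines_pos
  have h4 : (m * (4096 * L) ^ 2 : ℝ) ≤ 2 * L * n :=
    le_trans (by gcongr; linarith) h1
  have h5 : (2 * L : ℝ) * (m * (8388608 * L)) ≤ 2 * L * n := by nlinarith
  exact le_of_mul_le_mul_left h5 (by linarith)

theorem machines_le_width (h : LayerParams d L m n ρ) : (8388608 * m : ℝ) ≤ n := by
  have hL2 : (2 : ℝ) ≤ L := by exact_mod_cast h.two_le
  have hm : (0 : ℝ) < m := by exact_mod_cast h.machines_pos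
  have := h.machines_mul_le
  nlinarith

theorem width_pos (h : LayerParams d L m n ρ) : 0 < n := by
  have := h.machines_le_width
  have hm : (0 : ℝ) < m := by exact_mod_cast h.machines_pos
  exact_mod_cast (by linarith : (0 : ℝ) < n)

theorem degree_le_width (h : LayerParams d L m n ρ) : d ≤ n := by
  have h1 : (m : ℝ) ≤ n := by have := h.machines_le_width; linarith [(m.cast_nonneg : (0 : ℝ) ≤ m)]
  have h2 : m ≤ n := by exact_mod_cast h1
  have := h.degree_sq_le
  nlinarith [h.two_le_degree]

theorem layers_le_width (h : LayerParams d L m n ρ) : L ≤ n := by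
  have := h.degree; have := h.degree_le_width; omega

theorem ceil_delay_le (h : LayerParams d L m n ρ) : (⌈ρ⌉₊ : ℝ) ≤ 3 * m := by
  have h1 := Nat.ceil_lt_add_one h.delay_pos.le
  have h2 := h.lt_machines
  have hm : (1 : ℝ) ≤ m := by exact_mod_cast h.machines_pos
  linarith

theorem ceil_delay_le_width (h : LayerParams d L m n ρ) : ⌈ρ⌉₊ ≤ n := by
  have h1 := h.ceil_delay_le
  have h2 := h.machines_le_width
  have hm : (0 : ℝ) < m := by exact_mod_cast h.machines_pos
  exact_mod_cast (by linarith : (⌈ρ⌉₊ : ℝ) ≤ n)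

/-- One factor `n` is at least `m ^ 2 / (2 L)`, the other two are at least large multiples of `m`
and `m L`; the product is a large multiple of `m ^ 4`. -/
theorem ceil_delay_pow_le (h : LayerParams d L m n ρ) : 256 * ⌈ρ⌉₊ ^ 4 ≤ n ^ 3 := by
  have hL2 : (2 : ℝ) ≤ L := by exact_mod_cast h.two_le
  have hm : (0 : ℝ) < m := by exact_mod_cast h.machines_pos
  have h1 := h.ceil_delay_le
  have h2 : (m * m : ℝ) ≤ 2 * L * n := le_trans (by gcongr; exact h.machines_le) h.le_mul_width
  have h3 : (m * m : ℝ) * (8388608 * m) ≤ 2 * L * n * n := by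
    have := h.machines_le_width; gcongr
  have h4 := h.machines_mul_le
  have h5 : (m * m : ℝ) * (8388608 * m) * (m * (8388608 * L)) ≤ 2 * L * n * n * n := by gcongr
  have h6 : (2 * L : ℝ) * (256 * (3 * m) ^ 4) ≤ 2 * L * n ^ 3 := by
    have : (0 : ℝ) ≤ L * m ^ 4 := by positivity
    nlinarith
  have h7 : (256 * (⌈ρ⌉₊ : ℝ) ^ 4) ≤ n ^ 3 :=
    le_trans (by gcongr) (le_of_mul_le_mul_left h6 (by linarith))
  exact_mod_cast h7

/-- Here the degree must exceed a multiple of `L`: `w ≥ n / (32 m) ≥ ρ / (64 L)`, and since `ρ ≥ 1`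
the left side is at most `4 ρ + w ≤ (256 L + 1) w`. -/
theorem ceil_delay_add_le (h : LayerParams d L m n ρ) :
    ⌈ρ⌉₊ + (n / (32 * m) + 1) + 2 ≤ d / 8 * (n / (32 * m) + 1) := by
  have hL2 : (2 : ℝ) ≤ L := by exact_mod_cast h.two_le
  have hm : (1 : ℝ) ≤ m := by exact_mod_cast h.machines_pos
  set w := n / (32 * m) + 1 with hw
  have hw1 : (n : ℝ) ≤ 32 * m * w := by
    have := Nat.lt_mul_div_succ n (show 0 < 32 * m by have := h.machines_pos; omega)
    exact_mod_cast this.le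
  have h1 : (ρ : ℝ) ≤ 64 * L * w := by
    have := h.le_mul_width
    have h2 : (m * ρ : ℝ) ≤ m * (64 * L * w) := by nlinarith
    exact le_of_mul_le_mul_left h2 (by linarith)
  have h3 : 256 * L + 1 ≤ d / 8 := by have := h.degree; have := h.two_le; omega
  have h4 : (256 * L + 1 : ℝ) ≤ (d / 8 : ℕ) := by exact_mod_cast h3
  have h5 := Nat.ceil_lt_add_one h.delay_pos.le
  have h6 := h.machines_le
  have h7 : ((⌈ρ⌉₊ : ℝ) + w + 2) ≤ (d / 8 : ℕ) * w := by
    have : (256 * L + 1 : ℝ) * w ≤ (d / 8 : ℕ) * w := by gcongr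
    linarith
  exact_mod_cast h7

theorem nonempty_embedding (h : LayerParams d L m n ρ) : Nonempty (Fin d ↪ Fin n) :=
  ⟨Fin.castLEEmb h.degree_le_width⟩

theorem uniformProb_not_isExpanding_le (h : LayerParams d L m n ρ) :
    uniformProb (fun g : LayeredChoice d L n => ¬ IsExpanding m ⌈ρ⌉₊ g) ≤ 2 / n := by
  classical
  have := h.nonempty_embedding
  have hn : (0 : ℝ) < n := by exact_mod_cast h.width_pos
  have hm := h.machines_pos
  let 𝒟 : Finset (Finset (Fin n)) := Finset.univ.filter fun D => 16 * D.card ≤ n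
  let 𝒰 : Finset (Finset (Fin n)) := Finset.univ.powersetCard ⌈ρ⌉₊
  -- `n / 32 + 1` and `n / (32 * m) + 1` are the least numbers of vertices that violate expansion.
  have hD := uniformProb_exists_many_le (d := d) (L := L) h.width_pos 𝒟 (q := 1 / 16)
    (fun D hD => by
      have : 16 * D.card ≤ n := (Finset.mem_filter.1 hD).2
      have : (16 * D.card : ℝ) ≤ n := by exact_mod_cast this
      linarith) (n / 32 + 1)
  have hU := uniformProb_exists_many_le (d := d) (L := L) h.width_pos 𝒰 (q := ⌈ρ⌉₊ / n)
    (fun U hU => by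
      rw [(Finset.mem_powersetCard.1 hU).2, div_mul_cancel₀ _ hn.ne']) (n / (32 * m) + 1)
  have hDcard : (𝒟.card : ℝ) ≤ 2 ^ n := by
    have : 𝒟.card ≤ 2 ^ n := (Finset.card_le_univ _).trans (by simp)
    exact_mod_cast this
  have hUcard : (𝒰.card : ℝ) ≤ n ^ ⌈ρ⌉₊ := by
    rw [Finset.card_powersetCard, Finset.card_univ, Fintype.card_fin]
    exact_mod_cast Nat.choose_le_pow n _
  have hDc : (n.choose (n / 32 + 1) : ℝ) ≤ 2 ^ n := by
    exact_mod_cast Nat.choose_le_two_pow n _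
  have hUc : (n.choose (n / (32 * m) + 1) : ℝ) ≤ n ^ (n / (32 * m) + 1) := by
    exact_mod_cast Nat.choose_le_pow n _
  have hD' := hD.trans (le_trans (by gcongr) (union_bound_small_sets (w := n / 32 + 1)
    (by have := h.degree; have := h.two_le; omega) h.layers_le_width h.width_pos (by omega)))
  have hU' := hU.trans (le_trans (by gcongr) (union_bound_machine_sets (Nat.mul_div_le d 8)
    h.layers_le_width h.width_pos h.ceil_delay_pow_le h.ceil_delay_add_le))
  refine le_trans (uniformProb_mono fun g hg => ?_) ((uniformProb_or_le _ _).trans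
    ((add_le_add hD' hU').trans (by rw [← add_div]; norm_num)))
  simp only [IsExpanding, not_forall] at hg
  obtain ⟨k, hk⟩ := hg
  rcases not_and_or.1 hk with hk | hk
  · left
    push Not at hk
    obtain ⟨D, hD, hlt⟩ := hk
    exact ⟨k, D, Finset.mem_filter.2 ⟨Finset.mem_univ _, hD⟩, by omega⟩
  · right
    push Not at hk
    obtain ⟨U, hUt, hlt⟩ := hk
    -- Enlarging `U` only adds bad vertices, so sets of exactly `⌈ρ⌉₊` elements suffice.
    obtain ⟨T, hUT, hT⟩ := Finset.exists_superset_card_eq hUt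
      (by simpa using h.ceil_delay_le_width)
    refine ⟨k, T, Finset.mem_powersetCard.2 ⟨Finset.subset_univ _, hT⟩, ?_⟩
    rw [Nat.succ_le_iff, Nat.div_lt_iff_lt_mul (by omega), mul_comm]
    refine hlt.trans_le (Nat.mul_le_mul_left _ (Finset.card_le_card ?_))
    intro v hv
    refine Finset.mem_filter.2 ⟨Finset.mem_univ _, (Finset.mem_filter.1 hv).2.trans ?_⟩
    refine Nat.mul_le_mul_left _ (Finset.card_le_card fun j hj => ?_)
    exact Finset.mem_filter.2 ⟨Finset.mem_univ _, hUT (Finset.mem_filter.1 hj).2⟩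

theorem lpFeasible (h : LayerParams d L m n ρ) (hρ : 0 < ρ) (g : LayeredChoice d L n) :
    (layeredInstance d L n m ρ hρ g).LPFeasible ρ :=
  layeredInstance_lpFeasible h.two_le_degree h.machines_pos hρ
    (by rw [← h.machines]; exact h.machines_le) h.mul_width_le g

theorem le_makespan_and_gap (h : LayerParams d L m n ρ) (hρ : 0 < ρ) {g : LayeredChoice d L n}
    (hg : IsExpanding m ⌈ρ⌉₊ g) :
    (∀ σ, (layeredInstance d L n m ρ hρ g).IsSchedule σ →
      1 / 2 * L * ρ ≤ (layeredInstance d L n m ρ hρ g).makespan σ) ∧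
    1 / 2 * (L : ℝ) ≤ (layeredInstance d L n m ρ hρ g).gap := by
  have h1 : ∀ σ, (layeredInstance d L n m ρ hρ g).IsSchedule σ →
      1 / 2 * L * ρ ≤ (layeredInstance d L n m ρ hρ g).makespan σ :=
    fun σ hσ => makespan_lower_bound h.machines_pos h.two_le h.width_pos hg hσ
  exact ⟨h1, gap_lower_bound h.machines_pos (by have := h.two_le; omega) h.width_pos
    (h.lpFeasible hρ g) h1 (by positivity)⟩

theorem le_uniformProb_isExpanding (h : LayerParams d L m n ρ) :
    1 - 2 / n ≤ uniformProb (fun g : LayeredChoice d L n => IsExpanding m ⌈ρ⌉₊ g) := by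
  have := h.nonempty_embedding
  have h1 := one_le_uniformProb_add_not (fun g : LayeredChoice d L n => IsExpanding m ⌈ρ⌉₊ g)
  have h2 := h.uniformProb_not_isExpanding_le
  linarith

end LayerParams

end RandomLayers

/-! ### The random family with `K = 1`: `d = 2 ^ L` and `ρ = 2 ^ (L ^ 2)`. -/

section Asymptotics

theorem famDelay_one (L : ℕ) : famDelay 1 L = 2 ^ (L * L) := by
  rw [famDelay, famDegree, one_mul, ← pow_mul]

theorem famWidth_eq_floor (K L : ℕ) :
    famWidth K L = ⌊(famDelay K L : ℝ) * (famDelay K L : ℝ) / L⌋₊ := by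
  rw [famWidth, ← Nat.cast_mul, Nat.floor_div_natCast, Nat.floor_natCast]

theorem mul_le_two_pow {L : ℕ} (h : 17 ≤ L) : 4096 * L ≤ 2 ^ L := by
  induction L, h using Nat.le_induction with
  | base => norm_num
  | succ k hk ih => rw [pow_succ]; omega

theorem layerParams_fam {L : ℕ} (hL : 17 ≤ L) :
    LayerParams (famDegree 1 L) L (famDelay 1 L) (famWidth 1 L) (famDelay 1 L) where
  two_le := by omega
  degree := by rw [famDegree, one_mul]; exact mul_le_two_pow hL
  machines := rfl
  machines_le := le_rfl
  lt_machines := by have := famDelay_pos 1 L; linarith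
  width := famWidth_eq_floor 1 L

/-- The width is `2 ^ (2 L ^ 2) / L` rounded down, and `1 ≤ L ≤ 2 ^ L`. -/
theorem logb_famWidth_bounds {L : ℕ} (hL : 1 ≤ L) :
    2 * (L : ℝ) ^ 2 - L ≤ Real.logb 2 (famWidth 1 L) ∧
      Real.logb 2 (famWidth 1 L) ≤ 2 * (L : ℝ) ^ 2 := by
  have hlow : 2 ^ (2 * L ^ 2 - L) ≤ famWidth 1 L := by
    rw [famWidth, famDelay_one, Nat.le_div_iff_mul_le (by omega), ← pow_add]
    calc 2 ^ (2 * L ^ 2 - L) * L ≤ 2 ^ (2 * L ^ 2 - L) * 2 ^ L :=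
          Nat.mul_le_mul_left _ Nat.lt_two_pow_self.le
      _ = 2 ^ (L * L + L * L) := by
          rw [← pow_add]; congr 1
          have : L ≤ L ^ 2 := Nat.le_self_pow (by norm_num) L
          have h2 : L * L = L ^ 2 := (sq L).symm
          omega
  have hup : famWidth 1 L ≤ 2 ^ (2 * L ^ 2) := by
    rw [famWidth, famDelay_one, ← pow_add]
    refine (Nat.div_le_self _ _).trans (le_of_eq ?_)
    ring_nf
  have hpos : 0 < famWidth 1 L := lt_of_lt_of_le (by positivity) hlow
  have hpos' : (0 : ℝ) < famWidth 1 L := by exact_mod_cast hpos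
  constructor
  · rw [Real.le_logb_iff_rpow_le (by norm_num) hpos']
    have h1 : (2 * (L : ℝ) ^ 2 - L) = ((2 * L ^ 2 - L : ℕ) : ℝ) := by
      have : L ≤ L ^ 2 := Nat.le_self_pow (by norm_num) L
      rw [Nat.cast_sub (by omega)]; push_cast; ring
    rw [h1, Real.rpow_natCast]
    exact_mod_cast hlow
  · rw [Real.logb_le_iff_le_rpow (by norm_num) hpos']
    have h1 : (2 * (L : ℝ) ^ 2) = ((2 * L ^ 2 : ℕ) : ℝ) := by push_cast; ring
    rw [h1, Real.rpow_natCast]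
    exact_mod_cast hup

theorem tendsto_div_sqrt_logb_famWidth :
    Tendsto (fun L : ℕ => (L : ℝ) / √(Real.logb 2 (famWidth 1 L))) atTop (𝓝 (1 / √2)) := by
  have h1 : Tendsto (fun L : ℕ => Real.logb 2 (famWidth 1 L) / (L : ℝ) ^ 2) atTop (𝓝 2) := by
    have hlow : Tendsto (fun L : ℕ => (2 : ℝ) - 1 / L) atTop (𝓝 2) := by
      simpa using (tendsto_const_nhds (x := (2 : ℝ))).sub (tendsto_one_div_atTop_nhds_zero_nat (𝕜 := ℝ))
    refine tendsto_of_tendsto_of_tendsto_of_le_of_le' hlow tendsto_const_nhds ?_ ?_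
    · filter_upwards [eventually_ge_atTop 1] with L hL
      have hL' : (0 : ℝ) < L := by exact_mod_cast hL
      rw [le_div_iff₀ (by positivity)]
      refine le_trans (le_of_eq ?_) (logb_famWidth_bounds hL).1
      field_simp
    · filter_upwards [eventually_ge_atTop 1] with L hL
      have hL' : (0 : ℝ) < L := by exact_mod_cast hL
      rw [div_le_iff₀ (by positivity)]
      exact (logb_famWidth_bounds hL).2
  have h2 := ((Real.continuous_sqrt.tendsto 2).comp h1).inv₀ (by positivity)
  rw [one_div]
  refine h2.congr fun L => ?_
  simp only [Function.comp_apply]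
  rw [Real.sqrt_div' _ (by positivity), Real.sqrt_sq (by positivity), inv_div]

theorem logb_famDegree_one (L : ℕ) : Real.logb 2 (famDegree 1 L) = L := by
  rw [famDegree, one_mul, Nat.cast_pow, Real.logb_pow]
  simp

/-- Turns the gap `L / 2` into a bound in `ρ`: `log ρ = L ^ 2 log 2 ≤ L ^ 2`. -/
theorem sqrt_log_famDelay_le (L : ℕ) : √(Real.log (famDelay 1 L)) ≤ L := by
  rw [famDelay_one]
  refine Real.sqrt_le_iff.2 ⟨by positivity, ?_⟩
  push_cast
  rw [Real.log_pow]
  push_cast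
  have := Real.log_two_lt_d9
  nlinarith [sq_nonneg (L : ℝ)]

theorem famInstance_lpFeasible {L : ℕ} (hL : 1 ≤ L)
    (g : LayeredChoice (famDegree 1 L) L (famWidth 1 L)) :
    (famInstance 1 L g).LPFeasible (famDelay 1 L) := by
  refine layeredInstance_lpFeasible ?_ ?_ (famDelay_pos 1 L) le_rfl ?_ g
  · rw [famDegree, one_mul]; exact Nat.le_self_pow (by omega) 2
  · exact_mod_cast famDelay_pos 1 L
  · exact_mod_cast Nat.mul_div_le _ _

theorem tendsto_famWidth_inv : Tendsto (fun L : ℕ => (1 : ℝ) - 2 / famWidth 1 L) atTop (𝓝 1) := by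
  have h : Tendsto (famWidth 1) atTop atTop := by
    refine tendsto_atTop_mono' _ ?_ tendsto_id
    filter_upwards [eventually_ge_atTop 17] with L hL
    exact (layerParams_fam hL).layers_le_width
  simpa using (tendsto_const_nhds (x := (1 : ℝ))).sub
    ((tendsto_const_div_atTop_nhds_zero_nat (2 : ℝ)).comp h)

theorem tendsto_uniformProb_famInstance :
    Tendsto (fun L : ℕ => uniformProb (fun g : LayeredChoice (famDegree 1 L) L (famWidth 1 L) =>
      (∀ σ, (famInstance 1 L g).IsSchedule σ →
        1 / 2 * L * (famDelay 1 L : ℝ) ≤ (famInstance 1 L g).makespan σ) ∧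
      1 / 2 * √(Real.log (famDelay 1 L)) ≤ (famInstance 1 L g).gap)) atTop (𝓝 1) := by
  refine tendsto_of_tendsto_of_tendsto_of_le_of_le' tendsto_famWidth_inv tendsto_const_nhds ?_
    (Eventually.of_forall fun L => uniformProb_le_one _)
  filter_upwards [eventually_ge_atTop 17] with L hL
  have h := layerParams_fam hL
  refine h.le_uniformProb_isExpanding.trans (uniformProb_mono fun g hg => ?_)
  obtain ⟨h1, h2⟩ := h.le_makespan_and_gap (famDelay_pos 1 L) hg
  refine ⟨h1, le_trans ?_ h2⟩
  have := sqrt_log_famDelay_le L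
  linarith

end Asymptotics

/-! ### Parameters for an arbitrary large delay. -/

section AllDelays

theorem LayerParams.exists_isExpanding {d L m n : ℕ} {ρ : ℝ} (h : LayerParams d L m n ρ) :
    ∃ g : LayeredChoice d L n, IsExpanding m ⌈ρ⌉₊ g := by
  refine exists_of_uniformProb_pos (lt_of_lt_of_le ?_ h.le_uniformProb_isExpanding)
  have h1 : 3 ≤ n := by
    have := h.degree_le_width; have := h.degree; have := h.two_le; omega
  have h2 : (3 : ℝ) ≤ n := by exact_mod_cast h1
  rw [sub_pos, div_lt_one (by linarith)]
  linarith

/-- Every large delay `ρ = exp (s ^ 2)` lies in `[d ^ L, 2 d ^ L)` with `L ≈ s` and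
`log d ≈ s`. -/
theorem exists_layerParams {s : ℝ} (hs : 20 ≤ s) :
    ∃ d L : ℕ, LayerParams d L (d ^ L) ⌊((d ^ L : ℕ) : ℝ) * Real.exp (s ^ 2) / L⌋₊
        (Real.exp (s ^ 2)) ∧
      1 / 2 * s ≤ L ∧ L ≤ s ∧ (2 : ℝ) ^ s ≤ d ∧ (d : ℝ) ≤ 2 ^ (4 * s) := by
  set L := ⌊s⌋₊ with hLdef
  have hL20 : 20 ≤ L := Nat.le_floor (by exact_mod_cast hs)
  have hLs : (L : ℝ) ≤ s := Nat.floor_le (by linarith)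
  have hsL : s < L + 1 := Nat.lt_floor_add_one s
  have hL0 : (0 : ℝ) < L := by exact_mod_cast (by omega : 0 < L)
  -- `x` is the real `L`-th root of the delay, and `d` is its integer part.
  set x := Real.exp (s ^ 2 / L) with hx
  set d := ⌊x⌋₊ with hd
  have hxL : x ^ L = Real.exp (s ^ 2) := by
    rw [hx, ← Real.exp_nat_mul]; congr 1; field_simp
  have hdx : (d : ℝ) ≤ x := Nat.floor_le (Real.exp_pos _).le
  have hxd : x < d + 1 := Nat.lt_floor_add_one x
  have hsx : Real.exp s ≤ x := by
    rw [hx, Real.exp_le_exp, le_div_iff₀ hL0]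
    nlinarith
  have hl1 := Real.log_two_gt_d9
  have hl2 := Real.log_two_lt_d9
  have h2s : (2 : ℝ) ^ s ≤ d := by
    -- The factor `2` absorbs the rounding of `x` to `d`.
    have h1 : 2 * (2 : ℝ) ^ s ≤ Real.exp s := by
      rw [Real.rpow_def_of_pos (by norm_num)]
      nth_rewrite 1 [← Real.exp_log (show (0 : ℝ) < 2 by norm_num)]
      rw [← Real.exp_add, Real.exp_le_exp]
      nlinarith
    have h2 : (1 : ℝ) ≤ 2 ^ s := Real.one_le_rpow (by norm_num) (by linarith)
    linarith
  have hd4 : (d : ℝ) ≤ 2 ^ (4 * s) := by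
    refine hdx.trans ?_
    rw [hx, Real.rpow_def_of_pos (by norm_num), Real.exp_le_exp, div_le_iff₀ hL0]
    have h1 : s ≤ 2 * L := by linarith
    have h2 : s * s ≤ s * (2 * L) := by gcongr
    have h3 : 0 ≤ s * L := by positivity
    nlinarith
  have hdeg : 4096 * L ≤ d := by
    refine (mul_le_two_pow (by omega : 17 ≤ L)).trans ?_
    have : ((2 ^ L : ℕ) : ℝ) ≤ d := by
      push_cast
      rw [← Real.rpow_natCast]
      exact (Real.rpow_le_rpow_of_exponent_le (by norm_num) hLs).trans h2s
    exact_mod_cast this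
  have hdeg' : (4096 * L : ℝ) ≤ d := by exact_mod_cast hdeg
  have hd0 : (0 : ℝ) < d := by linarith
  refine ⟨d, L, ⟨by omega, hdeg, rfl, ?_, ?_, rfl⟩, by linarith, hLs, h2s, hd4⟩
  · rw [← hxL]; push_cast; gcongr
  -- Rounding costs a factor of at most `(1 + 1 / d) ^ L ≤ exp (L / d)`, below `2` because `d` is
  -- much larger than `L`.
  · have h1 : (1 + 1 / d : ℝ) ^ L ≤ Real.exp (1 / 2) := by
      calc (1 + 1 / d : ℝ) ^ L ≤ Real.exp (1 / d) ^ L := by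
            gcongr
            linarith [Real.add_one_le_exp (1 / d : ℝ)]
        _ = Real.exp (L * (1 / d)) := (Real.exp_nat_mul _ _).symm
        _ ≤ Real.exp (1 / 2) := by
            rw [Real.exp_le_exp, mul_one_div, div_le_iff₀ hd0]; linarith
    have h2 : Real.exp (1 / 2) < 2 := by
      rw [← Real.lt_log_iff_exp_lt (by norm_num)]; linarith
    calc Real.exp (s ^ 2) = x ^ L := hxL.symm
      _ ≤ (d + 1) ^ L := by gcongr
      _ = (1 + 1 / d : ℝ) ^ L * d ^ L := by rw [← mul_pow]; congr 1; field_simp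
      _ < 2 * d ^ L := by gcongr; linarith
      _ = _ := by push_cast; ring

end AllDelays

theorem theorem2 :
    -- the random layered instances with parameters `d`, `L`, `ρ = d ^ L = m`, `n = ⌊m ρ / L⌋`
    (∃ K : ℕ, 1 ≤ K ∧
      -- `L ~ ε₁ √(log n)` and `d = 2 ^ ((1 + o(1)) ε₂ √(log n))`
      (∃ ε₁ : ℝ, 0 < ε₁ ∧ Tendsto
        (fun L : ℕ => (L : ℝ) / √(Real.logb 2 (famWidth K L))) atTop (𝓝 ε₁)) ∧
      (∃ ε₂ : ℝ, 0 < ε₂ ∧ Tendsto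
        (fun L : ℕ => Real.logb 2 (famDegree K L) / √(Real.logb 2 (famWidth K L)))
        atTop (𝓝 ε₂)) ∧
      -- the linear program always has a solution of value `ρ`
      (∀ L : ℕ, 1 ≤ L → ∀ g : LayeredChoice (famDegree K L) L (famWidth K L),
        (famInstance K L g).LPFeasible (famDelay K L)) ∧
      -- with probability `1 - o(1)`, every schedule takes at least `c L` phases of length `ρ`
      (∃ c : ℝ, 0 < c ∧ Tendsto
        (fun L : ℕ => uniformProb (fun g : LayeredChoice (famDegree K L) L (famWidth K L) =>
          (∀ σ, (famInstance K L g).IsSchedule σ →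
            c * L * (famDelay K L : ℝ) ≤ (famInstance K L g).makespan σ) ∧
          c * √(Real.log (famDelay K L)) ≤ (famInstance K L g).gap))
        atTop (𝓝 1))) ∧
    -- for every large delay `ρ` there is such a layered instance with gap `Ω(√(log ρ))`
    (∃ c a₁ a₂ b₁ b₂ ρ₀ : ℝ, 0 < c ∧ 0 < a₁ ∧ 0 < a₂ ∧ 0 < b₁ ∧ 0 < b₂ ∧
      ∀ (ρ : ℝ) (hρ : 0 < ρ), ρ₀ ≤ ρ →
        ∃ (d L m n : ℕ) (g : LayeredChoice d L n),
          2 ≤ d ∧ 2 ≤ L ∧ m = d ^ L ∧ (m : ℝ) ≤ ρ ∧ ρ < 2 * m ∧ n = ⌊m * ρ / L⌋₊ ∧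
          a₁ * √(Real.log ρ) ≤ L ∧ L ≤ a₂ * √(Real.log ρ) ∧
          (2 : ℝ) ^ (b₁ * √(Real.log ρ)) ≤ d ∧ d ≤ (2 : ℝ) ^ (b₂ * √(Real.log ρ)) ∧
          (layeredInstance d L n m ρ hρ g).LPFeasible ρ ∧
          0 < (layeredInstance d L n m ρ hρ g).lpValue ∧
          (layeredInstance d L n m ρ hρ g).lpValue ≤ ρ ∧
          (∃ σ, (layeredInstance d L n m ρ hρ g).IsSchedule σ) ∧
          (∀ σ, (layeredInstance d L n m ρ hρ g).IsSchedule σ →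
            c * L * ρ ≤ (layeredInstance d L n m ρ hρ g).makespan σ) ∧
          c * √(Real.log ρ) ≤ (layeredInstance d L n m ρ hρ g).gap) := by
  refine ⟨⟨1, le_rfl, ⟨1 / √2, by positivity, tendsto_div_sqrt_logb_famWidth⟩,
    ⟨1 / √2, by positivity, ?_⟩, fun L hL g => famInstance_lpFeasible hL g,
    ⟨1 / 2, by norm_num, tendsto_uniformProb_famInstance⟩⟩,
    -- `c = 1 / 4` since the gap is at least `L / 2` and `L ≥ √(log ρ) / 2`; `exp 400` ensures
    -- `√(log ρ) ≥ 20`.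
    1 / 4, 1 / 2, 1, 1, 4, Real.exp 400, by norm_num, by norm_num, by norm_num, by norm_num,
    by norm_num, ?_⟩
  · simpa only [logb_famDegree_one] using tendsto_div_sqrt_logb_famWidth
  intro ρ hρ hρ₀
  have hlog : 400 ≤ Real.log ρ := (Real.le_log_iff_exp_le hρ).2 hρ₀
  have hs : 20 ≤ √(Real.log ρ) := Real.le_sqrt_of_sq_le (by linarith)
  obtain ⟨d, L, h, h1, h2, h3, h4⟩ := exists_layerParams hs
  rw [Real.sq_sqrt (by linarith), Real.exp_log hρ] at h
  obtain ⟨g, hg⟩ := h.exists_isExpanding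
  obtain ⟨hmake, hgap⟩ := h.le_makespan_and_gap hρ hg
  have hLP := h.lpFeasible hρ g
  obtain ⟨hv1, hv2⟩ := lpValue_mem_Icc (by have := h.two_le; omega) h.width_pos hLP
  refine ⟨d, L, d ^ L, _, g, h.two_le_degree, h.two_le, rfl, h.machines_le, h.lt_machines, rfl,
    h1, by linarith, by rwa [one_mul], h4, hLP, by linarith, hv2,
    exists_isSchedule h.machines_pos hρ g, fun σ hσ => le_trans ?_ (hmake σ hσ), by linarith⟩
  gcongr
  norm_num
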